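/- Let $|\cdot|$ be a norm on $\mathbb{R}$ and let $\alpha\in\mathbb{R}$ be such that $\sum_{y\in\mathbb{Z}\setminus\{0\}}|y|^{\alpha}<\infty$. Consider the ferromagnetic Ising model on $\mathbb{Z}$ without magnetic field and with coupling constants $J_{i,j}=J_{j-i}$, $J_y=|y|^{\alpha}e^{-|y|}$ for $y\neq 0$: for a finite set $\Lambda\subset\mathbb{Z}$, let $\langle\cdot\rangle_{\Lambda,\beta}$ be the expectation under the probability measure on $\{-1,1\}^{\Lambda}$ proportional to $\exp\bigl(\beta\sum_{\{i,j\}\subset\Lambda}J_{j-i}\,\sigma_i\sigma_j\bigr)$, where each unordered pair of distinct sites is counted once, and let $\langle\sigma_0\sigma_x\rangle_{\beta}=\lim_{\Lambda\uparrow\mathbb{Z}}\langle\sigma_0\sigma_x\rangle_{\Lambda,\beta}$ be the infinite-volume pair correlation. Then there is $\beta_0>0$ such that, for every $\beta\in(0,\beta_0)$, this limit exists for all $x\in\mathbb{Z}$, and there is a constant $c_\beta>0$ such that, for all $x\in\mathbb{Z}\setminus\{0\}$, $$c_\beta^{-1}\,|x|^{\alpha}e^{-|x|}\;\le\;\langle\sigma_0\sigma_x\rangle_{\beta}\;\le\;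 c_\beta\,|x|^{\alpha}e^{-|x|}.$$ In particular, the pair correlation decays like the coupling itself, and the (one-dimensional) Ornstein–Zernike asymptotics fail: for every $\beta\in(0,\beta_0)$ and every direction $s\in\{1,-1\}$ there are no $A>0$ and $\nu>0$ such that $\langle\sigma_0\sigma_{ns}\rangle_{\beta}=A\,e^{-\nu n}(1+\mathsf{o}(1))$ as $n\to\infty$. -/

import Mathlib

open scoped Topology

noncomputable section

/-- `J_y = |y|^α e^{-|y|}`, where `|·|` is the norm on `ℝ` given by `p`. (The value at `y = 0` is
never used: the Hamiltonian only involves pairs of distinct sites.) -/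
def expCoupling (p : Seminorm ℝ ℝ) (α : ℝ) (y : ℤ) : ℝ :=
  (p (y : ℝ)) ^ α * Real.exp (-p (y : ℝ))

namespace Ising

/-- Spin configurations in the finite volume `Λ ⊂ ℤ`; a spin is an element of `ℤˣ = {1, -1}`. -/
abbrev Config (Λ : Finset ℤ) : Type := Λ → ℤˣ

/-- The value `±1` of the spin at the site `i`, as a real number. -/
def spin {Λ : Finset ℤ} (i : Λ) (σ : Config Λ) : ℝ := ((σ i : ℤ) : ℝ)

/-- The Hamiltonian in `Λ` without magnetic field and with free boundary condition,
`H_Λ(σ) = - ∑_{{i,j} ⊂ Λ} J_{j-i} σ_i σ_j`, each unordered pair `{i, j}` being counted once. -/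
def hamiltonian (J : ℤ → ℝ) (Λ : Finset ℤ) (σ : Config Λ) : ℝ :=
  -∑ e : Λ × Λ with e.1 < e.2, J ((e.2 : ℤ) - (e.1 : ℤ)) * (spin e.1 σ * spin e.2 σ)

/-- The Boltzmann weight `e^{-β H_Λ(σ)}`. -/
def weight (J : ℤ → ℝ) (β : ℝ) (Λ : Finset ℤ) (σ : Config Λ) : ℝ :=
  Real.exp (-β * hamiltonian J Λ σ)

/-- The partition function in `Λ`. -/
def partitionFunction (J : ℤ → ℝ) (β : ℝ) (Λ : Finset ℤ) : ℝ :=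
  ∑ σ : Config Λ, weight J β Λ σ

/-- The expectation of `f` under the finite-volume Gibbs measure in `Λ`. -/
def expectation (J : ℤ → ℝ) (β : ℝ) (Λ : Finset ℤ) (f : Config Λ → ℝ) : ℝ :=
  (∑ σ : Config Λ, f σ * weight J β Λ σ) / partitionFunction J β Λ

/-- The finite-volume pair correlation `⟨σ_i σ_j⟩_{Λ,β}`, for `i, j ∈ Λ` (and `0` otherwise). -/
def finiteCorrelation (J : ℤ → ℝ) (β : ℝ) (Λ : Finset ℤ) (i j : ℤ) : ℝ :=
  if h : i ∈ Λ ∧ j ∈ Λ then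
    expectation J β Λ (fun σ => spin ⟨i, h.1⟩ σ * spin ⟨j, h.2⟩ σ)
  else 0

/-- The infinite-volume pair correlation `⟨σ_0 σ_x⟩_β`: the limit of the finite-volume ones as
`Λ ↑ ℤ` (along the directed set of all finite subsets of `ℤ`). -/
def pairCorrelation (J : ℤ → ℝ) (β : ℝ) (x : ℤ) : ℝ :=
  Filter.limUnder Filter.atTop (fun Λ : Finset ℤ => finiteCorrelation J β Λ 0 x)

end Ising

/-- Ornstein–Zernike asymptotics of `G : ℤ → ℝ` in the direction `s ∈ {1, -1}`:
`G(ns) = A n^{-(d-1)/2} e^{-ν n} (1 + o(1))` as `n → ∞`, for some `A, ν > 0`. Here `d = 1`, so that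
the power of `n` is equal to `1`. -/
def HasOrnsteinZernikeAsymptotics (G : ℤ → ℝ) (s : ℤˣ) : Prop :=
  ∃ A : ℝ, 0 < A ∧ ∃ ν : ℝ, 0 < ν ∧
    Asymptotics.IsEquivalent Filter.atTop (fun n : ℕ => G ((s : ℤ) * (n : ℤ)))
      (fun n : ℕ => A * Real.exp (-ν * (n : ℝ)))

end

/-! The lower bound costs a single bond: by Griffiths, the correlation of two sites is at least
`tanh (β * J x)`, and this is comparable to `β * J x` because `J` is bounded off `0`.

The upper bound rests on `sum_expCoupling_mul_le`: `J * J ≤ C J`. Indeed the triangle inequality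
handles the exponentials, and summability forces `α < 0`, so the prefactor of the longer of two
steps from `0` to `x` is at most `(|x| / 2) ^ α`, leaving a summable factor for the other. Expanding
the correlation over its first step (`finiteCorrelation_le_sum`) and writing `g` for the largest
ratio of correlation to coupling in a finite volume gives `g ≤ β + β * C * g`, hence `g ≤ 2 * β` at
high temperature, uniformly in the volume (`finiteCorrelation_le`). The limit exists since
correlations are bounded and increase with the volume.

As `α < 0`, the factor `|x| ^ α` tends to zero but is not exponentially small, so no pure
exponential can match the coupling up to constants. -/

namespace Ising

/-- A sign, viewed as a real number. -/
noncomputable def signR (u : ℤˣ) : ℝ := ((u : ℤ) : ℝ)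

@[simp] lemma signR_one : signR 1 = 1 := by simp [signR]

@[simp] lemma signR_neg_one : signR (-1) = -1 := by simp [signR]

@[simp] lemma signR_mul (u v : ℤˣ) : signR (u * v) = signR u * signR v := by simp [signR]

lemma signR_le_one (u : ℤˣ) : signR u ≤ 1 := by
  rcases Int.units_eq_one_or u with rfl | rfl <;> norm_num

lemma neg_one_le_signR (u : ℤˣ) : -1 ≤ signR u := by
  rcases Int.units_eq_one_or u with rfl | rfl <;> norm_num

lemma exp_mul_signR (a : ℝ) (u : ℤˣ) :
    Real.exp (a * signR u) = Real.cosh a + Real.sinh a * signR u := by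
  rcases Int.units_eq_one_or u with rfl | rfl
  · simp [Real.cosh_add_sinh]
  · simp [← Real.cosh_sub_sinh, sub_eq_add_neg]

/-! ### Griffiths inequalities for characters of a finite group -/

section Abstract

variable {G ι : Type*} [CommGroup G] [Fintype ι]

/-- The Boltzmann weight of a generalized Ising model, whose configurations form a group and whose
interactions are characters `c k` with couplings `K k`. -/
noncomputable def boltzmann (c : ι → G →* ℤˣ) (K : ι → ℝ) (σ : G) : ℝ :=
  Real.exp (∑ k, K k * signR (c k σ))

lemma boltzmann_pos (c : ι → G →* ℤˣ) (K : ι → ℝ) (σ : G) : 0 < boltzmann c K σ :=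
  Real.exp_pos _

variable [Fintype G]

/-- The unnormalized expectation of the character `χ`. -/
noncomputable def charSum (c : ι → G →* ℤˣ) (K : ι → ℝ) (χ : G →* ℤˣ) : ℝ :=
  ∑ σ, signR (χ σ) * boltzmann c K σ

/-- The expectation of the character `χ`. -/
noncomputable def charMean (c : ι → G →* ℤˣ) (K : ι → ℝ) (χ : G →* ℤˣ) : ℝ :=
  charSum c K χ / charSum c K 1

lemma charSum_one (c : ι → G →* ℤˣ) (K : ι → ℝ) : charSum c K 1 = ∑ σ, boltzmann c K σ := by
  simp [charSum]

lemma charSum_one_pos (c : ι → G →* ℤˣ) (K : ι → ℝ) : 0 < charSum c K 1 := by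
  rw [charSum_one]
  exact Finset.sum_pos (fun σ _ => boltzmann_pos c K σ) Finset.univ_nonempty

lemma charSum_le (c : ι → G →* ℤˣ) (K : ι → ℝ) (χ : G →* ℤˣ) :
    charSum c K χ ≤ charSum c K 1 := by
  rw [charSum_one]
  refine Finset.sum_le_sum fun σ _ => ?_
  exact mul_le_of_le_one_left (boltzmann_pos c K σ).le (signR_le_one _)

/-- If flipping by `g` preserves the interactions and changes the sign of `χ`, then `χ` has zero
mean. -/
lemma charSum_eq_zero (c : ι → G →* ℤˣ) (K : ι → ℝ) (χ : G →* ℤˣ) (g : G)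
    (hg : ∀ k, K k = 0 ∨ c k g = 1) (hχ : χ g = -1) : charSum c K χ = 0 := by
  have h : charSum c K χ = -charSum c K χ := by
    conv_lhs => rw [charSum, ← Equiv.sum_comp (Equiv.mulLeft g)]
    rw [charSum, ← Finset.sum_neg_distrib]
    refine Finset.sum_congr rfl fun σ _ => ?_
    have : boltzmann c K (g * σ) = boltzmann c K σ := by
      unfold boltzmann
      congr 1
      refine Finset.sum_congr rfl fun k _ => ?_
      rcases hg k with h | h <;> simp [h]
    rw [Equiv.coe_mulLeft, this, map_mul, hχ, signR_mul, signR_neg_one]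
    ring
  linarith

/-- The first Griffiths inequality, for a product of factors `a k + b k * c k`. -/
lemma sum_signR_mul_prod_nonneg (c : ι → G →* ℤˣ) (a b : ι → ℝ) (ha : ∀ k, 0 ≤ a k)
    (hb : ∀ k, 0 ≤ b k) (s : Finset ι) (χ : G →* ℤˣ) :
    0 ≤ ∑ σ, signR (χ σ) * ∏ k ∈ s, (a k + b k * signR (c k σ)) := by
  classical
  induction s using Finset.induction_on generalizing χ with
  | empty =>
    -- Orthogonality of characters: a nontrivial `χ` sums to zero. With zero couplings every `g` is
    -- a symmetry.
    by_cases h : ∃ g, χ g = -1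
    · obtain ⟨g, hg⟩ := h
      have := charSum_eq_zero (ι := ι) c 0 χ g (by simp) hg
      simp only [charSum, boltzmann, Pi.zero_apply, zero_mul, Finset.sum_const_zero,
        Real.exp_zero] at this
      simpa using this.ge
    · push Not at h
      refine Finset.sum_nonneg fun σ _ => ?_
      rw [(Int.units_eq_one_or (χ σ)).resolve_right (h σ)]
      simp
  | insert k s hk ih =>
    have h : ∀ σ, signR (χ σ) * ∏ l ∈ insert k s, (a l + b l * signR (c l σ)) =
        a k * (signR (χ σ) * ∏ l ∈ s, (a l + b l * signR (c l σ))) +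
        b k * (signR ((χ * c k) σ) * ∏ l ∈ s, (a l + b l * signR (c l σ))) := by
      intro σ
      rw [Finset.prod_insert hk, MonoidHom.mul_apply, signR_mul]
      ring
    simp only [h, Finset.sum_add_distrib, ← Finset.mul_sum]
    exact add_nonneg (mul_nonneg (ha k) (ih χ)) (mul_nonneg (hb k) (ih _))

/-- The first Griffiths inequality. -/
lemma charSum_nonneg (c : ι → G →* ℤˣ) (K : ι → ℝ) (hK : ∀ k, 0 ≤ K k) (χ : G →* ℤˣ) :
    0 ≤ charSum c K χ := by
  have := sum_signR_mul_prod_nonneg c (fun k => Real.cosh (K k)) (fun k => Real.sinh (K k))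
    (fun k => (Real.cosh_pos _).le) (fun k => Real.sinh_nonneg_iff.2 (hK k)) Finset.univ χ
  simpa only [charSum, boltzmann, Real.exp_sum, exp_mul_signR] using this

lemma charMean_nonneg (c : ι → G →* ℤˣ) (K : ι → ℝ) (hK : ∀ k, 0 ≤ K k) (χ : G →* ℤˣ) :
    0 ≤ charMean c K χ :=
  div_nonneg (charSum_nonneg c K hK χ) (charSum_one_pos c K).le

lemma charMean_le_one (c : ι → G →* ℤˣ) (K : ι → ℝ) (χ : G →* ℤˣ) : charMean c K χ ≤ 1 :=
  (div_le_one (charSum_one_pos c K)).2 (charSum_le c K χ)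

/-- The second Griffiths inequality: means of characters increase with the couplings. -/
lemma charMean_mono (c : ι → G →* ℤˣ) (K L : ι → ℝ) (hK : ∀ k, 0 ≤ K k) (hKL : ∀ k, K k ≤ L k)
    (χ : G →* ℤˣ) : charMean c K χ ≤ charMean c L χ := by
  rw [charMean, charMean, div_le_div_iff₀ (charSum_one_pos c K) (charSum_one_pos c L), ← sub_nonneg]
  -- Ginibre's duplication: with the second copy written as `σ * τ`, for fixed `τ` the joint weight
  -- is again a Boltzmann weight in `σ`, with couplings that are nonnegative because `0 ≤ K ≤ L`.
  have h : charSum c L χ * charSum c K 1 - charSum c K χ * charSum c L 1 =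
      ∑ τ, (1 - signR (χ τ)) * charSum c (fun k => L k + K k * signR (c k τ)) χ := by
    calc charSum c L χ * charSum c K 1 - charSum c K χ * charSum c L 1
        = ∑ σ, ∑ σ', (signR (χ σ) - signR (χ σ')) * (boltzmann c L σ * boltzmann c K σ') := by
          rw [charSum_one, charSum_one, mul_comm (charSum c K χ), charSum, charSum,
            Finset.sum_mul_sum, Finset.sum_mul_sum, ← Finset.sum_sub_distrib]
          refine Finset.sum_congr rfl fun σ _ => ?_
          rw [← Finset.sum_sub_distrib]
          exact Finset.sum_congr rfl fun σ' _ => by ring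
      _ = ∑ σ, ∑ τ, (signR (χ σ) - signR (χ (σ * τ))) *
            (boltzmann c L σ * boltzmann c K (σ * τ)) := by
          refine Finset.sum_congr rfl fun σ _ => ?_
          rw [← Equiv.sum_comp (Equiv.mulLeft σ)]
          rfl
      _ = ∑ τ, (1 - signR (χ τ)) * charSum c (fun k => L k + K k * signR (c k τ)) χ := by
          rw [Finset.sum_comm]
          refine Finset.sum_congr rfl fun τ _ => ?_
          rw [charSum, Finset.mul_sum]
          refine Finset.sum_congr rfl fun σ _ => ?_
          have : boltzmann c L σ * boltzmann c K (σ * τ) =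
              boltzmann c (fun k => L k + K k * signR (c k τ)) σ := by
            unfold boltzmann
            rw [← Real.exp_add, ← Finset.sum_add_distrib]
            congr 1
            refine Finset.sum_congr rfl fun k _ => ?_
            rw [map_mul, signR_mul]
            ring
          rw [this, map_mul, signR_mul]
          ring
  rw [h]
  refine Finset.sum_nonneg fun τ _ => mul_nonneg (sub_nonneg.2 (signR_le_one _)) ?_
  refine charSum_nonneg _ _ (fun k => ?_) _
  nlinarith [hK k, hKL k, neg_one_le_signR (c k τ)]

lemma charSum_update [DecidableEq ι] (c : ι → G →* ℤˣ) (K : ι → ℝ) (χ : G →* ℤˣ) (k : ι) :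
    charSum c K χ = Real.cosh (K k) * charSum c (Function.update K k 0) χ +
      Real.sinh (K k) * charSum c (Function.update K k 0) (χ * c k) := by
  simp only [charSum, Finset.mul_sum, ← Finset.sum_add_distrib]
  refine Finset.sum_congr rfl fun σ _ => ?_
  have h : boltzmann c K σ =
      Real.exp (K k * signR (c k σ)) * boltzmann c (Function.update K k 0) σ := by
    unfold boltzmann
    rw [← Real.exp_add, ← Finset.add_sum_erase _ _ (Finset.mem_univ k),
      ← Finset.add_sum_erase _ (fun l => Function.update K k 0 l * _) (Finset.mem_univ k)]
    congr 2
    simp only [Function.update_self, zero_mul, zero_add]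
    refine Finset.sum_congr rfl fun l hl => ?_
    rw [Function.update_of_ne (Finset.ne_of_mem_erase hl)]
  rw [h, exp_mul_signR, MonoidHom.mul_apply, signR_mul]
  ring

lemma sinh_le_mul_cosh {a : ℝ} (ha : 0 ≤ a) : Real.sinh a ≤ a * Real.cosh a := by
  have h : MonotoneOn (fun a => a * Real.cosh a - Real.sinh a) (Set.Ici 0) := by
    refine monotoneOn_of_deriv_nonneg (convex_Ici 0) (by fun_prop) (by fun_prop) fun x hx => ?_
    have hd : HasDerivAt (fun a => a * Real.cosh a - Real.sinh a)
        (1 * Real.cosh x + x * Real.sinh x - Real.cosh x) x :=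
      ((hasDerivAt_id x).mul (Real.hasDerivAt_cosh x)).sub (Real.hasDerivAt_sinh x)
    rw [interior_Ici] at hx
    rw [hd.deriv]
    nlinarith [mul_nonneg (le_of_lt hx) (Real.sinh_nonneg_iff.2 (le_of_lt hx))]
  have := h (Set.mem_Ici.2 le_rfl) (Set.mem_Ici.2 ha) ha
  simp at this
  linarith

/-- Expand the factor of bond `k` as `cosh + sinh * c k`. In the denominator the `sinh` term is
nonnegative and is dropped; in the numerator `sinh a ≤ a * cosh a`, so `cosh` cancels. -/
lemma charMean_le_update [DecidableEq ι] (c : ι → G →* ℤˣ) (K : ι → ℝ) (hK : ∀ k, 0 ≤ K k)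
    (χ : G →* ℤˣ) (k : ι) :
    charMean c K χ ≤ charMean c (Function.update K k 0) χ +
      K k * charMean c (Function.update K k 0) (χ * c k) := by
  have h0 : ∀ l, 0 ≤ Function.update K k 0 l := fun l => by
    by_cases h : l = k
    · subst h; simp
    · rw [Function.update_of_ne h]; exact hK l
  have hZ := charSum_one_pos c (Function.update K k 0)
  have hc := Real.cosh_pos (K k)
  have hs := Real.sinh_nonneg_iff.2 (hK k)
  calc charMean c K χ
      ≤ (Real.cosh (K k) * charSum c (Function.update K k 0) χ +
      K k * Real.cosh (K k) * charSum c (Function.update K k 0) (χ * c k)) /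
        (Real.cosh (K k) * charSum c (Function.update K k 0) 1) := by
        rw [charMean, charSum_update c K χ k, charSum_update c K 1 k]
        have h1 := charSum_nonneg c _ h0 (1 * c k)
        have h2 := charSum_nonneg c _ h0 (χ * c k)
        have h3 := charSum_nonneg c _ h0 χ
        gcongr
        · have := hK k
          positivity
        · exact sinh_le_mul_cosh (hK k)
        · exact le_add_of_nonneg_right (mul_nonneg hs h1)
    _ = _ := by
        unfold charMean
        field_simp

/-- Removing the interactions in `s`. -/
lemma charMean_le_remove [DecidableEq ι] (c : ι → G →* ℤˣ) (K : ι → ℝ) (hK : ∀ k, 0 ≤ K k)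
    (χ : G →* ℤˣ) (s : Finset ι) :
    charMean c K χ ≤ charMean c (fun k => if k ∈ s then 0 else K k) χ +
      ∑ k ∈ s, K k * charMean c K (χ * c k) := by
  induction s using Finset.induction_on with
  | empty => simp
  | insert k s hk ih =>
    have h0 : ∀ l, 0 ≤ (if l ∈ s then 0 else K l) := fun l => by
      split_ifs
      exacts [le_rfl, hK l]
    have hu : Function.update (fun l => if l ∈ s then 0 else K l) k 0 =
        fun l => if l ∈ insert k s then 0 else K l := by
      ext l
      by_cases h : l = k
      · subst h; simp
      · simp [h]
    have h1 := charMean_le_update c _ h0 χ k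
    rw [hu, if_neg hk] at h1
    -- Restoring the removed bonds only increases the correction term.
    have h2 : charMean c (fun l => if l ∈ insert k s then 0 else K l) (χ * c k) ≤
        charMean c K (χ * c k) := by
      refine charMean_mono c _ _ (fun l => ?_) (fun l => ?_) _ <;> split_ifs
      exacts [le_rfl, hK l, hK l, le_rfl]
    rw [Finset.sum_insert hk]
    have := mul_le_mul_of_nonneg_left h2 (hK k)
    linarith

/-- After cross-multiplying and expanding in bond `k`, the difference is `cosh ^ 2 - sinh ^ 2 = 1`
times the sum of `c k` without that bond, which is nonnegative. -/
lemma tanh_le_charMean (c : ι → G →* ℤˣ) (K : ι → ℝ) (hK : ∀ k, 0 ≤ K k) (k : ι) :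
    Real.tanh (K k) ≤ charMean c K (c k) := by
  classical
  have h0 : ∀ l, 0 ≤ Function.update K k 0 l := fun l => by
    by_cases h : l = k
    · subst h; simp
    · rw [Function.update_of_ne h]; exact hK l
  rw [Real.tanh_eq_sinh_div_cosh, charMean, div_le_div_iff₀ (Real.cosh_pos _) (charSum_one_pos c K),
    charSum_update c K (c k) k, charSum_update c K 1 k]
  have h : c k * c k = 1 := by
    ext σ
    simp
  rw [h, one_mul]
  have h1 := charSum_nonneg c _ h0 (c k)
  nlinarith [Real.cosh_sq (K k)]

end Abstract

end Ising
-- Finite-volume correlations and their infinite-volume limit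
namespace Ising

/-- The spin at the site `i`, as a character of the group of configurations. -/
def spinChar {Λ : Finset ℤ} (i : Λ) : Config Λ →* ℤˣ := Pi.evalMonoidHom _ i

lemma spinChar_apply {Λ : Finset ℤ} (i : Λ) (σ : Config Λ) : spinChar i σ = σ i := rfl

lemma spinChar_mul_self {Λ : Finset ℤ} (i : Λ) : spinChar i * spinChar i = 1 := by
  ext σ
  simp

/-- The product of the two spins of a pair of sites. -/
def bondChar {Λ : Finset ℤ} (e : Λ × Λ) : Config Λ →* ℤˣ := spinChar e.1 * spinChar e.2

/-- The coupling of a pair of sites, each unordered pair being counted once. -/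
noncomputable def bondCoupling (J : ℤ → ℝ) (β : ℝ) (Λ : Finset ℤ) (e : Λ × Λ) : ℝ :=
  if e.1 < e.2 then β * J ((e.2 : ℤ) - (e.1 : ℤ)) else 0

lemma bondCoupling_nonneg {J : ℤ → ℝ} (hJ : ∀ y, 0 ≤ J y) {β : ℝ} (hβ : 0 ≤ β) (Λ : Finset ℤ)
    (e : Λ × Λ) : 0 ≤ bondCoupling J β Λ e := by
  unfold bondCoupling
  split_ifs
  exacts [mul_nonneg hβ (hJ _), le_rfl]

lemma weight_eq (J : ℤ → ℝ) (β : ℝ) (Λ : Finset ℤ) (σ : Config Λ) :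
    weight J β Λ σ = boltzmann bondChar (bondCoupling J β Λ) σ := by
  unfold weight hamiltonian boltzmann
  rw [neg_mul_neg, Finset.mul_sum, Finset.sum_filter]
  congr 1
  refine Finset.sum_congr rfl fun e _ => ?_
  unfold bondCoupling bondChar
  split_ifs
  · rw [MonoidHom.mul_apply, signR_mul]
    simp only [spin, signR, spinChar_apply]
    ring
  · simp

lemma finiteCorrelation_eq (J : ℤ → ℝ) (β : ℝ) (Λ : Finset ℤ) (i j : Λ) :
    finiteCorrelation J β Λ i j =
      charMean bondChar (bondCoupling J β Λ) (spinChar i * spinChar j) := by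
  rw [finiteCorrelation, dif_pos ⟨i.2, j.2⟩, expectation, partitionFunction, charMean,
    charSum_one, charSum]
  simp only [weight_eq]
  congr 1
  refine Finset.sum_congr rfl fun σ _ => ?_
  rw [MonoidHom.mul_apply, signR_mul]
  rfl

lemma finiteCorrelation_nonneg {J : ℤ → ℝ} (hJ : ∀ y, 0 ≤ J y) {β : ℝ} (hβ : 0 ≤ β)
    (Λ : Finset ℤ) (i j : ℤ) : 0 ≤ finiteCorrelation J β Λ i j := by
  by_cases h : i ∈ Λ ∧ j ∈ Λ
  · rw [finiteCorrelation_eq J β Λ ⟨i, h.1⟩ ⟨j, h.2⟩]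
    exact charMean_nonneg _ _ (bondCoupling_nonneg hJ hβ Λ) _
  · rw [finiteCorrelation, dif_neg h]

lemma finiteCorrelation_le_one (J : ℤ → ℝ) (β : ℝ) (Λ : Finset ℤ) (i j : ℤ) :
    finiteCorrelation J β Λ i j ≤ 1 := by
  by_cases h : i ∈ Λ ∧ j ∈ Λ
  · rw [finiteCorrelation_eq J β Λ ⟨i, h.1⟩ ⟨j, h.2⟩]
    exact charMean_le_one _ _ _
  · rw [finiteCorrelation, dif_neg h]
    exact zero_le_one

/-- The sum of a function of the image under a surjective homomorphism. -/
lemma sum_comp_hom {G H : Type*} [Group G] [Group H] [Fintype G] [Fintype H] [DecidableEq H]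
    (φ : G →* H) (hφ : Function.Surjective φ) (F : H → ℝ) :
    ∑ g, F (φ g) = (Finset.univ.filter fun g => φ g = 1).card * ∑ h, F h := by
  rw [← Finset.sum_fiberwise Finset.univ φ, Finset.mul_sum]
  refine Finset.sum_congr rfl fun h _ => ?_
  rw [Finset.sum_congr rfl (g := fun _ => F h) (by simp +contextual), Finset.sum_const,
    nsmul_eq_mul, MonoidHom.card_fiber_eq_of_mem_range φ (hφ h) (hφ 1)]

/-- Pulling a model back along a surjective homomorphism does not change the means. -/
lemma charMean_comp {G H ι : Type*} [CommGroup G] [CommGroup H] [Fintype G] [Fintype H]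
    [Fintype ι] (φ : G →* H) (hφ : Function.Surjective φ) (c : ι → H →* ℤˣ) (K : ι → ℝ)
    (χ : H →* ℤˣ) :
    charMean (fun k => (c k).comp φ) K (χ.comp φ) = charMean c K χ := by
  classical
  have h : ∀ χ : H →* ℤˣ, charSum (fun k => (c k).comp φ) K (χ.comp φ) =
      (Finset.univ.filter fun g => φ g = 1).card * charSum c K χ := fun χ =>
    sum_comp_hom φ hφ fun σ => signR (χ σ) * boltzmann c K σ
  have h1 := h 1
  rw [MonoidHom.one_comp] at h1
  rw [charMean, charMean, h, h1]
  refine mul_div_mul_left _ _ ?_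
  exact Nat.cast_ne_zero.2 (Finset.card_ne_zero_of_mem (Finset.mem_filter.2
    ⟨Finset.mem_univ 1, map_one φ⟩))

/-- Reindexing of the interactions along an injection, the new ones being switched off. -/
lemma charMean_reindex {G ι κ : Type*} [CommGroup G] [Fintype G] [Fintype ι] [Fintype κ]
    (e : ι → κ) (he : Function.Injective e) (c : κ → G →* ℤˣ) (K : κ → ℝ)
    (hK : ∀ k, k ∉ Set.range e → K k = 0) (χ : G →* ℤˣ) :
    charMean (c ∘ e) (K ∘ e) χ = charMean c K χ := by
  have h : boltzmann (c ∘ e) (K ∘ e) = boltzmann c K := by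
    ext σ
    unfold boltzmann
    congr 1
    exact Fintype.sum_of_injective e he _ _ (fun k hk => by simp [hK k hk]) fun _ => rfl
  simp only [charMean, charSum, h]

/-- Pulled back along restriction of configurations, the model in the smaller volume is the larger
one with all bonds leaving it switched off, so the second Griffiths inequality applies. -/
lemma finiteCorrelation_mono {J : ℤ → ℝ} (hJ : ∀ y, 0 ≤ J y) {β : ℝ} (hβ : 0 ≤ β) (i j : ℤ) :
    Monotone fun Λ => finiteCorrelation J β Λ i j := by
  classical
  intro Λ Λ' hΛ
  dsimp only
  by_cases h : i ∈ Λ ∧ j ∈ Λ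
  swap
  · rw [finiteCorrelation, dif_neg h]
    exact finiteCorrelation_nonneg hJ hβ _ _ _
  let u : Λ → Λ' := fun x => ⟨x, hΛ x.2⟩
  have hu : Function.Injective u := fun x y hxy => Subtype.ext (congrArg (fun z : Λ' => (z : ℤ)) hxy)
  let φ : Config Λ' →* Config Λ :=
    { toFun := fun σ x => σ (u x), map_one' := rfl, map_mul' := fun _ _ => rfl }
  have hφ : Function.Surjective φ := hu.surjective_comp_right
  have he : Function.Injective (Prod.map u u) := hu.prodMap hu
  let K : Λ' × Λ' → ℝ := fun e => if e ∈ Set.range (Prod.map u u) then bondCoupling J β Λ' e else 0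
  have hKe : K ∘ Prod.map u u = bondCoupling J β Λ := by
    ext e
    exact if_pos ⟨e, rfl⟩
  rw [finiteCorrelation_eq J β Λ ⟨i, h.1⟩ ⟨j, h.2⟩,
    finiteCorrelation_eq J β Λ' ⟨i, hΛ h.1⟩ ⟨j, hΛ h.2⟩,
    ← charMean_comp φ hφ, ← hKe]
  refine (charMean_reindex (Prod.map u u) he bondChar K (fun k hk => if_neg hk) _).trans_le ?_
  refine charMean_mono _ _ _ (fun k => ?_) (fun k => ?_) _ <;>
    (dsimp only [K]; split_ifs)
  exacts [bondCoupling_nonneg hJ hβ _ _, le_rfl, le_rfl, bondCoupling_nonneg hJ hβ _ _]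

lemma tendsto_pairCorrelation {J : ℤ → ℝ} (hJ : ∀ y, 0 ≤ J y) {β : ℝ} (hβ : 0 ≤ β) (x : ℤ) :
    Filter.Tendsto (fun Λ : Finset ℤ => finiteCorrelation J β Λ 0 x) Filter.atTop
      (𝓝 (pairCorrelation J β x)) := by
  have h := tendsto_atTop_ciSup (finiteCorrelation_mono hJ hβ 0 x)
    ⟨1, by rintro _ ⟨Λ, rfl⟩; exact finiteCorrelation_le_one J β Λ 0 x⟩
  unfold pairCorrelation
  rwa [h.limUnder_eq]

/-- The pair of sites `i`, `y`, ordered increasingly. -/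
noncomputable def orderedBond {Λ : Finset ℤ} (i y : Λ) : Λ × Λ := if i < y then (i, y) else (y, i)

lemma orderedBond_injective {Λ : Finset ℤ} (i : Λ) : Function.Injective (orderedBond i) := by
  intro y z h
  unfold orderedBond at h
  split_ifs at h with h1 h2 h2 <;> simp only [Prod.mk.injEq] at h
  · exact h.2
  · exact h.2.trans h.1
  · exact h.1.trans h.2
  · exact h.1

lemma bondChar_orderedBond {Λ : Finset ℤ} (i y : Λ) :
    bondChar (orderedBond i y) = spinChar i * spinChar y := by
  unfold bondChar orderedBond
  split_ifs
  exacts [rfl, mul_comm _ _]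

lemma bondCoupling_orderedBond {J : ℤ → ℝ} (hJ : ∀ y, J (-y) = J y) (β : ℝ) {Λ : Finset ℤ}
    {i y : Λ} (h : y ≠ i) :
    bondCoupling J β Λ (orderedBond i y) = β * J ((y : ℤ) - i) := by
  unfold bondCoupling orderedBond
  by_cases h1 : i < y
  · simp only [if_pos h1]
  · have h2 : y < i := lt_of_le_of_ne (not_lt.1 h1) h
    simp only [if_neg h1, if_pos h2]
    rw [← hJ, neg_sub]

lemma tanh_le_finiteCorrelation {J : ℤ → ℝ} (hJ : ∀ y, 0 ≤ J y) (hJ' : ∀ y, J (-y) = J y) {β : ℝ}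
    (hβ : 0 ≤ β) {Λ : Finset ℤ} {i j : ℤ} (hi : i ∈ Λ) (hj : j ∈ Λ) (hij : j ≠ i) :
    Real.tanh (β * J (j - i)) ≤ finiteCorrelation J β Λ i j := by
  have h := tanh_le_charMean bondChar _ (bondCoupling_nonneg hJ hβ Λ)
    (orderedBond ⟨i, hi⟩ ⟨j, hj⟩)
  rwa [bondCoupling_orderedBond hJ' β (by simpa using hij), bondChar_orderedBond,
    ← finiteCorrelation_eq] at h

lemma finiteCorrelation_self (J : ℤ → ℝ) (β : ℝ) {Λ : Finset ℤ} {i : ℤ} (hi : i ∈ Λ) :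
    finiteCorrelation J β Λ i i = 1 := by
  rw [finiteCorrelation_eq J β Λ ⟨i, hi⟩ ⟨i, hi⟩, spinChar_mul_self]
  exact div_self (charSum_one_pos _ _).ne'

/-- A Simon–Lieb type inequality: the correlation is dominated by a sum over the first step. -/
lemma finiteCorrelation_le_sum {J : ℤ → ℝ} (hJ : ∀ y, 0 ≤ J y) (hJ' : ∀ y, J (-y) = J y) {β : ℝ}
    (hβ : 0 ≤ β) {Λ : Finset ℤ} {i j : ℤ} (hi : i ∈ Λ) (hj : j ∈ Λ) (hij : j ≠ i) :
    finiteCorrelation J β Λ i j ≤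
      ∑ y ∈ Λ.erase i, β * J (y - i) * finiteCorrelation J β Λ y j := by
  classical
  let i' : Λ := ⟨i, hi⟩
  let j' : Λ := ⟨j, hj⟩
  have hij' : j' ≠ i' := fun h => hij (congrArg Subtype.val h)
  have h := charMean_le_remove bondChar _ (bondCoupling_nonneg hJ hβ Λ) (spinChar i' * spinChar j')
    ((Finset.univ.erase i').image (orderedBond i'))
  rw [Finset.sum_image (orderedBond_injective i').injOn] at h
  -- With every bond at `i` removed, flipping the spin at `i` is a symmetry that reverses the sign
  -- of the product.
  have h0 : charMean bondChar (fun k => if k ∈ (Finset.univ.erase i').image (orderedBond i') then 0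
      else bondCoupling J β Λ k) (spinChar i' * spinChar j') = 0 := by
    have h1 : ∀ y : Λ, y ≠ i' → (Pi.mulSingle i' (-1) : Config Λ) y = 1 := fun y hy =>
      Pi.mulSingle_eq_of_ne hy _
    rw [charMean, charSum_eq_zero _ _ _ (Pi.mulSingle i' (-1)), zero_div]
    · rintro ⟨a, b⟩
      by_cases hs : (a, b) ∈ (Finset.univ.erase i').image (orderedBond i')
      · exact Or.inl (if_pos hs)
      rw [if_neg hs]
      by_cases hab : a < b
      swap
      · exact Or.inl (if_neg hab)
      right
      have ha : a ≠ i' := by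
        rintro rfl
        exact hs (Finset.mem_image.2 ⟨b, by simpa using hab.ne', by simp [orderedBond, hab]⟩)
      have hb : b ≠ i' := by
        rintro rfl
        exact hs (Finset.mem_image.2
          ⟨a, by simpa using hab.ne, by simp [orderedBond, hab.le.not_gt]⟩)
      simp [bondChar, spinChar_apply, h1 _ ha, h1 _ hb]
    · simp [spinChar_apply, h1 _ hij']
  rw [h0, zero_add, ← finiteCorrelation_eq] at h
  refine h.trans_eq ?_
  refine Finset.sum_nbij (fun y => (y : ℤ)) (fun y hy => ?_) Subtype.val_injective.injOn
    (fun y hy => ?_) fun y hy => ?_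
  · exact Finset.mem_erase.2 ⟨fun h => Finset.ne_of_mem_erase hy (Subtype.ext h), y.2⟩
  · obtain ⟨hyi, hyΛ⟩ := Finset.mem_erase.1 (Finset.mem_coe.1 hy)
    exact ⟨⟨y, hyΛ⟩, by simpa [i'] using hyi, rfl⟩
  · rw [bondCoupling_orderedBond hJ' β (Finset.ne_of_mem_erase hy), bondChar_orderedBond,
      finiteCorrelation_eq J β Λ y j']
    congr 2
    calc spinChar i' * spinChar j' * (spinChar i' * spinChar y)
        = (spinChar i' * spinChar i') * (spinChar y * spinChar j') := by
          rw [mul_mul_mul_comm, mul_comm (spinChar j')]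
      _ = spinChar y * spinChar j' := by rw [spinChar_mul_self, one_mul]

end Ising
-- Upper bound at high temperature
namespace Ising

/-- At high temperature, couplings that dominate their own convolution square dominate the
correlations, uniformly in the volume. -/
lemma finiteCorrelation_le {J : ℤ → ℝ} (hJ : ∀ y, 0 ≤ J y) (hJpos : ∀ y, y ≠ 0 → 0 < J y)
    (hJ' : ∀ y, J (-y) = J y) {C : ℝ}
    (hC : ∀ (T : Finset ℤ) (x : ℤ), x ≠ 0 → 0 ∉ T → x ∉ T → ∑ y ∈ T, J y * J (x - y) ≤ C * J x)
    {β : ℝ} (hβ : 0 ≤ β) (hβC : β * C ≤ 1 / 2) {Λ : Finset ℤ} {i j : ℤ} (hi : i ∈ Λ) (hj : j ∈ Λ)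
    (hij : j ≠ i) : finiteCorrelation J β Λ i j ≤ 2 * β * J (j - i) := by
  let P := (Λ ×ˢ Λ).filter fun e => e.2 ≠ e.1
  have hP : ∀ a b, (a, b) ∈ P ↔ (a ∈ Λ ∧ b ∈ Λ) ∧ b ≠ a := fun a b => by simp [P]
  let g : ℤ × ℤ → ℝ := fun e => finiteCorrelation J β Λ e.1 e.2 / J (e.2 - e.1)
  -- The maximum is finite because `Λ` is, so the self-consistent bound below can be solved for it
  -- with no prior decay estimate.
  obtain ⟨⟨a, b⟩, hab, hmax⟩ := P.exists_max_image g ⟨(i, j), (hP i j).2 ⟨⟨hi, hj⟩, hij⟩⟩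
  obtain ⟨⟨ha, hb⟩, hne⟩ := (hP a b).1 hab
  have hle : ∀ y z, y ∈ Λ → z ∈ Λ → z ≠ y →
      finiteCorrelation J β Λ y z ≤ g (a, b) * J (z - y) := fun y z hy hz hyz =>
    (div_le_iff₀ (hJpos _ (sub_ne_zero.2 hyz))).1 (hmax (y, z) ((hP y z).2 ⟨⟨hy, hz⟩, hyz⟩))
  have hab0 := hJpos _ (sub_ne_zero.2 hne)
  have hg0 : 0 ≤ g (a, b) := div_nonneg (finiteCorrelation_nonneg hJ hβ _ _ _) (hJ _)
  have hconv : ∑ y ∈ (Λ.erase a).erase b, J (y - a) * J (b - y) ≤ C * J (b - a) := by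
    refine le_trans (le_of_eq ?_) (hC (((Λ.erase a).erase b).image (· - a)) (b - a)
      (sub_ne_zero.2 hne) (by simp [sub_eq_zero]) (by simp))
    rw [Finset.sum_image (sub_left_injective.injOn)]
    simp
  have hkey : g (a, b) * J (b - a) ≤ (β + β * C * g (a, b)) * J (b - a) := by
    calc g (a, b) * J (b - a) = finiteCorrelation J β Λ a b := div_mul_cancel₀ _ hab0.ne'
      _ ≤ ∑ y ∈ Λ.erase a, β * J (y - a) * finiteCorrelation J β Λ y b :=
        finiteCorrelation_le_sum hJ hJ' hβ ha hb hne
      _ = β * J (b - a) +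
          ∑ y ∈ (Λ.erase a).erase b, β * J (y - a) * finiteCorrelation J β Λ y b := by
        rw [← Finset.add_sum_erase _ _ (Finset.mem_erase.2 ⟨hne, hb⟩),
          finiteCorrelation_self J β hb, mul_one]
      _ ≤ β * J (b - a) +
          ∑ y ∈ (Λ.erase a).erase b, β * g (a, b) * (J (y - a) * J (b - y)) := by
        refine add_le_add le_rfl (Finset.sum_le_sum fun y hy => ?_)
        obtain ⟨hyb, hy⟩ := Finset.mem_erase.1 hy
        have := mul_le_mul_of_nonneg_left (hle y b (Finset.mem_of_mem_erase hy) hb hyb.symm)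
          (mul_nonneg hβ (hJ (y - a)))
        linarith
      _ ≤ β * J (b - a) + β * g (a, b) * (C * J (b - a)) := by
        rw [← Finset.mul_sum]
        gcongr
      _ = _ := by ring
  have h2 := le_of_mul_le_mul_right hkey hab0
  have h3 : g (a, b) ≤ 2 * β := by nlinarith
  exact (hle i j hi hj hij).trans (mul_le_mul_of_nonneg_right h3 (hJ _))

end Ising

/-! ### The coupling: convolution bound and failure of Ornstein–Zernike -/

section Coupling

variable (p : Seminorm ℝ ℝ) (α : ℝ)

lemma seminorm_intCast (y : ℤ) : p (y : ℝ) = |(y : ℝ)| * p 1 := by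
  simpa using map_smul_eq_mul p (y : ℝ) 1

lemma expCoupling_nonneg (y : ℤ) : 0 ≤ expCoupling p α y :=
  mul_nonneg (Real.rpow_nonneg (apply_nonneg p _) _) (Real.exp_pos _).le

lemma expCoupling_neg (y : ℤ) : expCoupling p α (-y) = expCoupling p α y := by
  simp [expCoupling, map_neg_eq_map]

variable {p α}

lemma seminorm_intCast_pos (hp : ∀ t : ℝ, p t = 0 → t = 0) {y : ℤ} (hy : y ≠ 0) :
    0 < p (y : ℝ) :=
  lt_of_le_of_ne (apply_nonneg p _) fun h => hy (by exact_mod_cast hp _ h.symm)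

lemma expCoupling_pos (hp : ∀ t : ℝ, p t = 0 → t = 0) {y : ℤ} (hy : y ≠ 0) :
    0 < expCoupling p α y :=
  mul_pos (Real.rpow_pos_of_pos (seminorm_intCast_pos hp hy) _) (Real.exp_pos _)

/-- For `α ≥ 0` the terms at positive integers stay above `p 1 ^ α > 0` and cannot tend to zero. -/
lemma exponent_neg (hp : ∀ t : ℝ, p t = 0 → t = 0)
    (hα : Summable (fun y : {y : ℤ // y ≠ 0} => (p ((y : ℤ) : ℝ)) ^ α)) : α < 0 := by
  by_contra! h
  have hinj : Function.Injective fun n : ℕ => (⟨n + 1, by omega⟩ : {y : ℤ // y ≠ 0}) := by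
    intro m n hmn
    have := congrArg Subtype.val hmn
    simp only at this
    omega
  have h1 := (hα.comp_injective hinj).tendsto_atTop_zero
  have hp1 : 0 < p 1 := by simpa using seminorm_intCast_pos hp one_ne_zero
  refine (Real.rpow_pos_of_pos hp1 α).not_ge (ge_of_tendsto' h1 fun n => ?_)
  refine Real.rpow_le_rpow hp1.le ?_ h
  rw [seminorm_intCast]
  refine le_mul_of_one_le_left hp1.le (le_trans ?_ (le_abs_self _))
  push_cast
  linarith [n.cast_nonneg (α := ℝ)]

/-- The convolution square of the coupling is dominated by the coupling. -/
lemma sum_expCoupling_mul_le (hp : ∀ t : ℝ, p t = 0 → t = 0)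
    (hα : Summable (fun y : {y : ℤ // y ≠ 0} => (p ((y : ℤ) : ℝ)) ^ α)) (T : Finset ℤ) (x : ℤ)
    (hx : x ≠ 0) (h0 : 0 ∉ T) (hxT : x ∉ T) :
    ∑ y ∈ T, expCoupling p α y * expCoupling p α (x - y) ≤
      (2 * (1 / 2) ^ α * ∑' y : {y : ℤ // y ≠ 0}, p ((y : ℤ) : ℝ) ^ α) * expCoupling p α x := by
  set S := ∑' y : {y : ℤ // y ≠ 0}, p ((y : ℤ) : ℝ) ^ α
  have hα0 := exponent_neg hp hα
  have hS : ∀ U : Finset ℤ, 0 ∉ U → ∑ y ∈ U, p (y : ℝ) ^ α ≤ S := by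
    intro U hU
    have h1 : ∑ y ∈ U, p (y : ℝ) ^ α = ∑ y ∈ U.subtype (· ≠ 0), p ((y : ℤ) : ℝ) ^ α := by
      rw [Finset.sum_subtype_of_mem (p := (· ≠ 0)) (fun y : ℤ => p (y : ℝ) ^ α)
        fun y hy h => hU (h ▸ hy)]
    rw [h1]
    exact hα.sum_le_tsum _ fun y _ => Real.rpow_nonneg (apply_nonneg p _) _
  have hxp := seminorm_intCast_pos hp hx
  have hterm : ∀ y ∈ T, expCoupling p α y * expCoupling p α (x - y) ≤
      (1 / 2) ^ α * expCoupling p α x * (p (y : ℝ) ^ α + p ((x - y : ℤ) : ℝ) ^ α) := by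
    intro y hy
    have hu : 0 < p (y : ℝ) := seminorm_intCast_pos hp fun h => h0 (h ▸ hy)
    have hv : 0 < p ((x - y : ℤ) : ℝ) :=
      seminorm_intCast_pos hp fun h => hxT ((sub_eq_zero.1 h) ▸ hy)
    have huv : p (x : ℝ) ≤ p (y : ℝ) + p ((x - y : ℤ) : ℝ) := by
      have := map_add_le_add p (y : ℝ) ((x - y : ℤ) : ℝ)
      simpa using this
    unfold expCoupling
    generalize p (y : ℝ) = u at *
    generalize p ((x - y : ℤ) : ℝ) = v at *
    generalize p (x : ℝ) = w at *
    -- The larger of `u`, `v` is at least `w / 2`, so its power is at most `(w / 2) ^ α`; the other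
    -- power is one of the summands.
    have hmul : u ^ α * v ^ α ≤ (1 / 2 * w) ^ α * (u ^ α + v ^ α) := by
      have hu' := Real.rpow_pos_of_pos hu α
      have hv' := Real.rpow_pos_of_pos hv α
      rcases le_total u v with h | h
      · have := Real.rpow_le_rpow_of_nonpos (z := α) (by linarith : 0 < 1 / 2 * w)
          (by linarith : 1 / 2 * w ≤ v) hα0.le
        nlinarith
      · have := Real.rpow_le_rpow_of_nonpos (z := α) (by linarith : 0 < 1 / 2 * w)
          (by linarith : 1 / 2 * w ≤ u) hα0.le
        nlinarith
    have hexp : Real.exp (-u) * Real.exp (-v) ≤ Real.exp (-w) := by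
      rw [← Real.exp_add]
      exact Real.exp_le_exp.2 (by linarith)
    rw [Real.mul_rpow (by norm_num) hxp.le] at hmul
    have := mul_le_mul hmul hexp (by positivity) (by positivity)
    linarith
  have hsub : ∑ y ∈ T, p ((x - y : ℤ) : ℝ) ^ α ≤ S := by
    refine le_trans (le_of_eq ?_) (hS (T.image (x - ·)) ?_)
    · rw [Finset.sum_image (sub_right_injective.injOn)]
    · simpa [sub_eq_zero] using hxT
  have hpos : 0 ≤ (1 / 2) ^ α * expCoupling p α x :=
    mul_nonneg (Real.rpow_nonneg (by norm_num) _) (expCoupling_nonneg p α x)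
  calc ∑ y ∈ T, expCoupling p α y * expCoupling p α (x - y)
      ≤ (1 / 2) ^ α * expCoupling p α x *
        (∑ y ∈ T, p (y : ℝ) ^ α + ∑ y ∈ T, p ((x - y : ℤ) : ℝ) ^ α) := by
        rw [← Finset.sum_add_distrib, Finset.mul_sum]
        exact Finset.sum_le_sum hterm
    _ ≤ (1 / 2) ^ α * expCoupling p α x * (S + S) := by
        gcongr
        exact hS T h0
    _ = _ := by ring

lemma expCoupling_le (hp : ∀ t : ℝ, p t = 0 → t = 0) (hα0 : α < 0) {y : ℤ} (hy : y ≠ 0) :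
    expCoupling p α y ≤ p 1 ^ α := by
  have hp1 : 0 < p 1 := by simpa using seminorm_intCast_pos hp one_ne_zero
  have h1 : p 1 ≤ p (y : ℝ) := by
    rw [seminorm_intCast]
    exact le_mul_of_one_le_left hp1.le (by exact_mod_cast Int.one_le_abs hy)
  calc expCoupling p α y ≤ p 1 ^ α * 1 := by
        refine mul_le_mul (Real.rpow_le_rpow_of_nonpos hp1 h1 hα0.le) ?_ (Real.exp_pos _).le
          (Real.rpow_nonneg hp1.le _)
        exact Real.exp_le_one_iff.2 (neg_nonpos.2 (apply_nonneg p _))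
    _ = _ := mul_one _

/-- A function comparable to the coupling does not have Ornstein–Zernike asymptotics. -/
lemma not_hasOrnsteinZernikeAsymptotics (hp : ∀ t : ℝ, p t = 0 → t = 0) (hα0 : α < 0)
    {G : ℤ → ℝ} {c : ℝ} (hc : 0 < c) (hlow : ∀ x, x ≠ 0 → c⁻¹ * expCoupling p α x ≤ G x)
    (hup : ∀ x, x ≠ 0 → G x ≤ c * expCoupling p α x) (s : ℤˣ) :
    ¬ HasOrnsteinZernikeAsymptotics G s := by
  rintro ⟨A, hA, ν, -, h⟩
  have hp1 : 0 < p 1 := by simpa using seminorm_intCast_pos hp one_ne_zero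
  have hx : Filter.Tendsto (fun n : ℕ => (n : ℝ) * p 1) Filter.atTop Filter.atTop :=
    tendsto_natCast_atTop_atTop.atTop_mul_const hp1
  rw [Asymptotics.isEquivalent_iff_tendsto_one
    (Filter.Eventually.of_forall fun n => (by positivity))] at h
  have hJ : ∀ n : ℕ, expCoupling p α ((s : ℤ) * n) / (A * Real.exp (-ν * n)) =
      A⁻¹ * (Real.exp ((ν - p 1) / p 1 * (n * p 1)) / (n * p 1) ^ (-α)) := by
    intro n
    have h1 : p (((s : ℤ) * n : ℤ) : ℝ) = n * p 1 := by
      rw [seminorm_intCast]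
      congr 1
      rcases Int.units_eq_one_or s with rfl | rfl <;> simp
    have h2 : (ν - p 1) / p 1 * (n * p 1) = -(n * p 1) - (-ν * n) := by
      field_simp
      ring
    rw [expCoupling, h1, h2, Real.exp_sub, Real.rpow_neg (by positivity)]
    field_simp
  have hne : ∀ᶠ n : ℕ in Filter.atTop, (s : ℤ) * (n : ℤ) ≠ 0 := by
    filter_upwards [Filter.eventually_gt_atTop 0] with n hn
    exact mul_ne_zero s.ne_zero (by exact_mod_cast hn.ne')
  have hle := h.eventually (gt_mem_nhds (show (1 : ℝ) < 2 by norm_num))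
  have hge := h.eventually (lt_mem_nhds (show (1 / 2 : ℝ) < 1 by norm_num))
  -- If `ν ≤ p 1`, the power `α < 0` sends the ratio to `0`; if `ν > p 1`, the exponential sends it
  -- to infinity. Either contradicts the limit `1`.
  rcases le_or_gt ν (p 1) with hν | hν
  · have h0 : Filter.Tendsto (fun n : ℕ => c * (A⁻¹ * ((n : ℝ) * p 1) ^ α)) Filter.atTop (𝓝 0) := by
      have := (tendsto_rpow_neg_atTop (neg_pos.2 hα0)).comp hx
      simp only [neg_neg] at this
      simpa using (this.const_mul A⁻¹).const_mul c
    obtain ⟨n, hn, h1, h2⟩ := (hne.and (hge.and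
      (h0.eventually (gt_mem_nhds (show (0 : ℝ) < 1 / 2 by norm_num))))).exists
    have h3 : G ((s : ℤ) * n) / (A * Real.exp (-ν * n)) ≤ c * (A⁻¹ * ((n : ℝ) * p 1) ^ α) := by
      calc G ((s : ℤ) * n) / (A * Real.exp (-ν * n))
          ≤ c * expCoupling p α ((s : ℤ) * n) / (A * Real.exp (-ν * n)) := by
            gcongr
            exact hup _ hn
        _ = c * (A⁻¹ * (Real.exp ((ν - p 1) / p 1 * (n * p 1)) / (n * p 1) ^ (-α))) := by
            rw [mul_div_assoc, hJ]
        _ ≤ c * (A⁻¹ * (1 / (n * p 1) ^ (-α))) := by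
            gcongr
            exact Real.exp_le_one_iff.2 (mul_nonpos_of_nonpos_of_nonneg
              (div_nonpos_of_nonpos_of_nonneg (by linarith) hp1.le) (by positivity))
        _ = _ := by rw [Real.rpow_neg (by positivity), one_div, inv_inv]
    simp only [Pi.div_apply] at h1
    linarith
  · have h0 : Filter.Tendsto (fun n : ℕ =>
        c⁻¹ * (A⁻¹ * (Real.exp ((ν - p 1) / p 1 * (n * p 1)) / (n * p 1) ^ (-α))))
        Filter.atTop Filter.atTop :=
      (((tendsto_exp_mul_div_rpow_atTop (-α) _ (div_pos (sub_pos.2 hν) hp1)).comp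
        hx).const_mul_atTop (inv_pos.2 hA)).const_mul_atTop (inv_pos.2 hc)
    obtain ⟨n, hn, h1, h2⟩ := (hne.and (hle.and (h0.eventually_ge_atTop 2))).exists
    rw [← hJ, ← mul_div_assoc] at h2
    have h3 : c⁻¹ * expCoupling p α ((s : ℤ) * n) / (A * Real.exp (-ν * n)) ≤
        G ((s : ℤ) * n) / (A * Real.exp (-ν * n)) := by
      gcongr
      exact hlow _ hn
    simp only [Pi.div_apply] at h1
    linarith

end Coupling

/-! ### Assembly of the theorem -/

theorem mainTheorem2 (p : Seminorm ℝ ℝ) (hp : ∀ t : ℝ, p t = 0 → t = 0) (α : ℝ)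
    (hα : Summable (fun y : {y : ℤ // y ≠ 0} => (p ((y : ℤ) : ℝ)) ^ α)) :
    ∃ β₀ : ℝ, 0 < β₀ ∧ ∀ β : ℝ, 0 < β → β < β₀ →
      (∀ x : ℤ, Filter.Tendsto
        (fun Λ : Finset ℤ => Ising.finiteCorrelation (expCoupling p α) β Λ 0 x)
        Filter.atTop (𝓝 (Ising.pairCorrelation (expCoupling p α) β x))) ∧
      (∃ c : ℝ, 0 < c ∧ ∀ x : ℤ, x ≠ 0 →
        c⁻¹ * ((p (x : ℝ)) ^ α * Real.exp (-p (x : ℝ)))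
            ≤ Ising.pairCorrelation (expCoupling p α) β x ∧
        Ising.pairCorrelation (expCoupling p α) β x
            ≤ c * ((p (x : ℝ)) ^ α * Real.exp (-p (x : ℝ)))) ∧
      (∀ s : ℤˣ, ¬ HasOrnsteinZernikeAsymptotics
        (Ising.pairCorrelation (expCoupling p α) β) s) := by
  have hα0 := exponent_neg hp hα
  have hJ := expCoupling_nonneg p α
  have hJ' := expCoupling_neg p α
  have hconv := sum_expCoupling_mul_le hp hα
  have hC0 : 0 ≤ 2 * (1 / 2 : ℝ) ^ α * ∑' y : {y : ℤ // y ≠ 0}, p ((y : ℤ) : ℝ) ^ α :=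
    mul_nonneg (by positivity) (tsum_nonneg fun y => Real.rpow_nonneg (apply_nonneg p _) _)
  generalize 2 * (1 / 2 : ℝ) ^ α * ∑' y : {y : ℤ // y ≠ 0}, p ((y : ℤ) : ℝ) ^ α = C at hconv hC0
  -- Chosen so that `β * C ≤ 1 / 2`; the `+ 1` covers `C = 0`.
  refine ⟨1 / (2 * (C + 1)), by positivity, fun β hβ hβ₀ => ?_⟩
  have hβC : β * C ≤ 1 / 2 := by
    rw [lt_div_iff₀ (by positivity)] at hβ₀
    linarith
  have htendsto := Ising.tendsto_pairCorrelation hJ hβ.le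
  have hmem : ∀ x : ℤ, ∀ᶠ Λ : Finset ℤ in Filter.atTop, 0 ∈ Λ ∧ x ∈ Λ := fun x => by
    filter_upwards [Filter.eventually_ge_atTop {0, x}] with Λ hΛ
    exact ⟨hΛ (by simp), hΛ (by simp)⟩
  have hup : ∀ x : ℤ, x ≠ 0 →
      Ising.pairCorrelation (expCoupling p α) β x ≤ 2 * β * expCoupling p α x := by
    intro x hx
    refine le_of_tendsto (htendsto x) ((hmem x).mono fun Λ hΛ => ?_)
    simpa using Ising.finiteCorrelation_le hJ (fun y => expCoupling_pos hp) hJ' hconv hβ.le hβC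
      hΛ.1 hΛ.2 hx
  -- In `tanh = sinh / cosh`, use `a ≤ sinh a` above and bound `cosh` at the largest possible
  -- coupling `p 1 ^ α`, making the constant independent of `x`.
  have hlow : ∀ x : ℤ, x ≠ 0 → β / Real.cosh (β * p 1 ^ α) * expCoupling p α x ≤
      Ising.pairCorrelation (expCoupling p α) β x := by
    intro x hx
    refine ge_of_tendsto (htendsto x) ((hmem x).mono fun Λ hΛ => ?_)
    have h1 := Ising.tanh_le_finiteCorrelation hJ hJ' hβ.le hΛ.1 hΛ.2 hx
    rw [sub_zero, Real.tanh_eq_sinh_div_cosh] at h1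
    refine le_trans ?_ h1
    have h2 : 0 ≤ β * expCoupling p α x := mul_nonneg hβ.le (hJ x)
    rw [div_mul_eq_mul_div]
    refine div_le_div₀ (Real.sinh_nonneg_iff.2 h2) (Real.self_le_sinh_iff.2 h2) (Real.cosh_pos _) ?_
    rw [Real.cosh_le_cosh, abs_of_nonneg h2, abs_of_nonneg (h2.trans
      (mul_le_mul_of_nonneg_left (expCoupling_le hp hα0 hx) hβ.le))]
    exact mul_le_mul_of_nonneg_left (expCoupling_le hp hα0 hx) hβ.le
  have hcosh := Real.cosh_pos (β * p 1 ^ α)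
  obtain ⟨c, hc, hc1, hc2⟩ : ∃ c : ℝ, 0 < c ∧ 2 * β ≤ c ∧ Real.cosh (β * p 1 ^ α) / β ≤ c :=
    ⟨max (2 * β) (Real.cosh (β * p 1 ^ α) / β), lt_max_of_lt_left (by positivity),
      le_max_left _ _, le_max_right _ _⟩
  have hlow' : ∀ x : ℤ, x ≠ 0 → c⁻¹ * expCoupling p α x ≤
      Ising.pairCorrelation (expCoupling p α) β x := fun x hx => by
    refine le_trans (mul_le_mul_of_nonneg_right ?_ (hJ x)) (hlow x hx)
    rw [← inv_div]
    exact inv_anti₀ (by positivity) hc2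
  have hup' : ∀ x : ℤ, x ≠ 0 → Ising.pairCorrelation (expCoupling p α) β x ≤
      c * expCoupling p α x := fun x hx =>
    (hup x hx).trans (mul_le_mul_of_nonneg_right hc1 (hJ x))
  exact ⟨htendsto, ⟨c, hc, fun x hx => ⟨hlow' x hx, hup' x hx⟩⟩,
    not_hasOrnsteinZernikeAsymptotics hp hα0 hc hlow' hup'⟩
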